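/- Let $\mathbf{OLoc}$ be the category of overt locales (those whose positive opens form a base, where $a>0$ means that every cover of $a$ is inhabited). For an overt locale $X$ write $\mathcal{O}X$ for its frame of opens, $a\oplus b=\pi_1^*(a)\wedge\pi_2^*(b)\in\mathcal{O}(X\times X)$, write $a\between b$ for $a\wedge b>0$, and for $E,F\in\mathcal{O}(X\times X)$ let $F\circ E=\{(x,z)\mid\exists y.\ (x,y)\in E\wedge(y,z)\in F\}$, where $\exists y$ is the left adjoint of the inverse image map of the projection $X^3\to X^2$, $(x,y,z)\mapsto(x,z)$. A *pre-uniform locale via entourages* is an overt locale $X$ with a filter $\mathcal{E}$ on $\mathcal{O}(X\times X)$ such that for each $E\in\mathcal{E}$: $\Delta^*(E)=1$, where $\Delta\colon X\to X\times X$ is the diagonal; the image of $E$ under the exchange of the two factors lies in $\mathcal{E}$; and $F\circ F\le E$ for some $F\in\mathcal{E}$. A morphism $(X,\mathcal{E})\to(Y,\mathcal{F})$ is a locale map $f\colon X\to Y$ with $(f\times f)^*(F)\in\mathcal{E}$ for all $F\in\mathcal{F}$. Put $a\vartriangleleft_{\mathcal{E}}b$ if $E\circ(a\oplus a)\le b\oplus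 b$ for some $E\in\mathcal{E}$. A *covering downset* on $X$ is a downset $U\subseteq\mathcal{O}X$ with $\bigvee U=1$; it is *strong* if it is generated by its positive elements. Put $\mathrm{st}(a,U)=\bigvee\{u\in U\mid a\between u\}$ and $U^\star={\downarrow}\{\mathrm{st}(u,U)\mid u\in U\}$. A *pre-uniform locale via covers* is an overt locale $X$ with a filter $\mathcal{U}$ of covering downsets such that for each $U\in\mathcal{U}$ there is a strong $V\in\mathcal{U}$ with $V^\star\subseteq U$. A morphism $(X,\mathcal{U})\to(Y,\mathcal{V})$ is a locale map $f\colon X\to Y$ with ${\downarrow}f^*[V]\in\mathcal{U}$ for all $V\in\mathcal{V}$. Put $a\vartriangleleft_{\mathcal{U}}b$ if $\mathrm{st}(a,U)\le b$ for some $U\in\mathcal{U}$. In both settings a pre-uniform locale is *uniform* if $b=\bigvee_{a\vartriangleleft b}a$ for every $b\in\mathcal{O}X$; uniform locales form a full subcategory. **Theorem.** There is an isomorphism of categories, commuting with the forgetful functors to $\mathbf{OLoc}$, between the category of pre-uniform locales via entourages and the category of pre-uniform locales via covers. If $(X,\mathcal{E})$ corresponds to $(X,\mathcal{U})$ under it,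 then $\mathcal{U}$ is the filter with base the covering downsets ${\downarrow}\{u\mid u>0,\ u\oplus u\le E\}$ for $E\in\mathcal{E}$; $\mathcal{E}$ is the filter with base the opens $\bigvee\{u\oplus u\mid u\in U\}$ for strong $U\in\mathcal{U}$; and the relations $\vartriangleleft_{\mathcal{E}}$ and $\vartriangleleft_{\mathcal{U}}$ coincide. Moreover, the isomorphism restricts to an isomorphism between the category of uniform locales via entourages and the category of uniform locales via covers. -/

import Mathlib

open CategoryTheory Order

universe u

noncomputable section

namespace ULoc

/-! ### The product of two locales

The frame `A ⊗ B` of opens of the product of the locales with frames of opens `A` and `B` (that is,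
the coproduct of the frames `A` and `B`) is the frame of saturated downsets of `A × B`: those
downsets closed under (possibly empty) joins in each coordinate separately.  The lemmas `lift_inl`,
`lift_inr` and `hom_ext` show that it has the universal property of the coproduct of frames. -/

section Product

variable {A B C : Type*} [Frame A] [Frame B] [Frame C]

/-- A downset of `A × B` is saturated if it is closed under joins in each coordinate. -/
def Saturated (G : LowerSet (A × B)) : Prop :=
  (∀ (S : Set A) (b : B), (∀ a ∈ S, (a, b) ∈ G) → (sSup S, b) ∈ G) ∧
    ∀ (a : A) (S : Set B), (∀ b ∈ S, (a, b) ∈ G) → (a, sSup S) ∈ G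

lemma mem_himp_iff (P Q : LowerSet (A × B)) (x : A × B) :
    x ∈ P ⇨ Q ↔ ∀ y ∈ P, y ≤ x → y ∈ Q := by
  rw [← LowerSet.Iic_le, le_himp_iff]
  constructor
  · intro h y hy hyx
    exact h ⟨LowerSet.mem_Iic_iff.2 hyx, hy⟩
  · rintro h y ⟨hy1, hy2⟩
    exact h y hy2 (LowerSet.mem_Iic_iff.1 hy1)

variable (A B) in
/-- The saturated downsets, as a sublocale of the locale of all downsets of `A × B`. -/
def saturatedSublocale : Sublocale (LowerSet (A × B)) where
  carrier := {G | Saturated G}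
  sInf_mem' := by
    intro s hs
    refine ⟨fun S b h => ?_, fun a S h => ?_⟩
    · rw [LowerSet.mem_sInf_iff]
      intro G hG
      exact (hs hG).1 S b fun a ha => LowerSet.mem_sInf_iff.1 (h a ha) G hG
    · rw [LowerSet.mem_sInf_iff]
      intro G hG
      exact (hs hG).2 a S fun b hb => LowerSet.mem_sInf_iff.1 (h b hb) G hG
  himp_mem' := by
    intro P Q hQ
    refine ⟨fun S b h => ?_, fun a S h => ?_⟩
    · rw [mem_himp_iff]
      rintro ⟨c, d⟩ hy ⟨hc, hd⟩
      have e : c = sSup ((fun a => c ⊓ a) '' S) := by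
        rw [sSup_image, ← inf_sSup_eq]; exact (inf_eq_left.2 hc).symm
      rw [e]
      refine hQ.1 _ d ?_
      rintro _ ⟨a, ha, rfl⟩
      exact (mem_himp_iff P Q _).1 (h a ha) (c ⊓ a, d)
        (P.lower (Prod.mk_le_mk.2 ⟨inf_le_left, le_rfl⟩) hy) ⟨inf_le_right, hd⟩
    · rw [mem_himp_iff]
      rintro ⟨c, d⟩ hy ⟨hc, hd⟩
      have e : d = sSup ((fun b => d ⊓ b) '' S) := by
        rw [sSup_image, ← inf_sSup_eq]; exact (inf_eq_left.2 hd).symm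
      rw [e]
      refine hQ.2 c _ ?_
      rintro _ ⟨b, hb, rfl⟩
      exact (mem_himp_iff P Q _).1 (h b hb) (c, d ⊓ b)
        (P.lower (Prod.mk_le_mk.2 ⟨le_rfl, inf_le_left⟩) hy) ⟨hc, inf_le_right⟩

variable (A B) in
/-- The frame of opens of the product of the locales with frames of opens `A` and `B`. -/
abbrev ProdOpens : Type _ := saturatedSublocale A B

scoped infixr:70 " ⊗ₗ " => ProdOpens

/-- The open rectangle `a ⊕ b`: the least open of the product that contains `(a, b)`. -/
def rect (a : A) (b : B) : A ⊗ₗ B :=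
  (saturatedSublocale A B).restrict (LowerSet.Iic (a, b))

lemma rect_le_iff {a : A} {b : B} {G : A ⊗ₗ B} : rect a b ≤ G ↔ (a, b) ∈ G.1 := by
  rw [rect, (saturatedSublocale A B).giRestrict.gc.le_iff_le, LowerSet.Iic_le]

lemma eq_iSup_rect (G : A ⊗ₗ B) : G = ⨆ p ∈ G.1, rect p.1 p.2 := by
  apply le_antisymm
  · intro p hp
    exact rect_le_iff.1 (le_iSup₂_of_le p hp le_rfl)
  · exact iSup₂_le fun p hp => rect_le_iff.2 hp

/-- The copairing of two frame homomorphisms, i.e. the inverse image map of the pairing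
`(f, g) : Z → X × Y` of two locale maps `f : Z → X` and `g : Z → Y`. -/
def lift (f : FrameHom A C) (g : FrameHom B C) : FrameHom (A ⊗ₗ B) C :=
  have gc : GaloisConnection (fun G : A ⊗ₗ B => ⨆ p ∈ G.1, f p.1 ⊓ g p.2)
      (fun c => (⟨⟨{p | f p.1 ⊓ g p.2 ≤ c}, fun p q h hp =>
        (inf_le_inf (OrderHomClass.mono f h.1) (OrderHomClass.mono g h.2)).trans hp⟩, by
        refine ⟨fun S b h => ?_, fun a S h => ?_⟩
        · change f (sSup S) ⊓ g b ≤ c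
          rw [map_sSup, sSup_inf_eq]
          refine iSup₂_le ?_
          rintro _ ⟨a, ha, rfl⟩
          exact h a ha
        · change f a ⊓ g (sSup S) ≤ c
          rw [map_sSup, inf_sSup_eq]
          refine iSup₂_le ?_
          rintro _ ⟨b, hb, rfl⟩
          exact h b hb⟩ : A ⊗ₗ B)) := by
    intro G c
    constructor
    · intro h p hp
      exact (le_iSup₂ (f := fun (p : A × B) (_ : p ∈ G.1) => f p.1 ⊓ g p.2) p hp).trans h
    · intro h
      exact iSup₂_le fun p hp => h hp
  { toFun := fun G => ⨆ p ∈ G.1, f p.1 ⊓ g p.2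
    map_inf' := by
      intro G H
      apply le_antisymm
      · exact le_inf (gc.monotone_l inf_le_left) (gc.monotone_l inf_le_right)
      · rw [iSup₂_inf_eq]
        refine iSup₂_le fun p hp => ?_
        rw [inf_iSup₂_eq]
        refine iSup₂_le fun q hq => ?_
        refine le_iSup₂_of_le (p ⊓ q) ⟨G.1.lower inf_le_left hp, H.1.lower inf_le_right hq⟩ ?_
        change _ ≤ f (p.1 ⊓ q.1) ⊓ g (p.2 ⊓ q.2)
        rw [map_inf, map_inf, inf_inf_inf_comm]
    map_top' := by
      refine top_unique (le_iSup₂_of_le (⊤ : A × B) trivial ?_)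
      change _ ≤ f ⊤ ⊓ g ⊤
      simp
    map_sSup' := by
      intro s
      change _ = sSup ((fun G : A ⊗ₗ B => ⨆ p ∈ G.1, f p.1 ⊓ g p.2) '' s)
      rw [sSup_image]
      exact gc.l_sSup }

lemma lift_apply (f : FrameHom A C) (g : FrameHom B C) (G : A ⊗ₗ B) :
    lift f g G = ⨆ p ∈ G.1, f p.1 ⊓ g p.2 := rfl

lemma lift_rect (f : FrameHom A C) (g : FrameHom B C) (a : A) (b : B) :
    lift f g (rect a b) = f a ⊓ g b := by
  apply le_antisymm
  · let K : A ⊗ₗ B := sSup {H | lift f g H ≤ f a ⊓ g b}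
    have hK : lift f g K ≤ f a ⊓ g b := by
      rw [map_sSup]
      refine sSup_le ?_
      rintro _ ⟨H, hH, rfl⟩
      exact hH
    let L : LowerSet (A × B) := ⟨{p | f p.1 ⊓ g p.2 ≤ f a ⊓ g b}, fun p q h hp =>
      (inf_le_inf (OrderHomClass.mono f h.1) (OrderHomClass.mono g h.2)).trans hp⟩
    have hL : L ∈ saturatedSublocale A B := by
      refine ⟨fun S b' h => ?_, fun a' S h => ?_⟩
      · change f (sSup S) ⊓ g b' ≤ _
        rw [map_sSup, sSup_inf_eq]
        refine iSup₂_le ?_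
        rintro _ ⟨x, hx, rfl⟩
        exact h x hx
      · change f a' ⊓ g (sSup S) ≤ _
        rw [map_sSup, inf_sSup_eq]
        refine iSup₂_le ?_
        rintro _ ⟨x, hx, rfl⟩
        exact h x hx
    have h : rect a b ≤ (⟨L, hL⟩ : A ⊗ₗ B) := rect_le_iff.2 (le_refl (f a ⊓ g b))
    rw [lift_apply]
    exact iSup₂_le fun p hp => h hp
  · exact le_iSup₂_of_le (f := fun (p : A × B) (_ : p ∈ (rect a b).1) => f p.1 ⊓ g p.2)
      (a, b) (rect_le_iff.1 le_rfl) le_rfl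

lemma rect_inf_rect (a a' : A) (b b' : B) :
    rect a b ⊓ rect a' b' = rect (a ⊓ a') (b ⊓ b') := by
  rw [rect, rect, rect, ← map_inf, ← LowerSet.Iic_inf]
  rfl

/-- The inverse image map of the first product projection, `a ↦ a ⊕ ⊤`. -/
def inl : FrameHom A (A ⊗ₗ B) where
  toFun a := rect a ⊤
  map_inf' a a' := by rw [rect_inf_rect, inf_idem]
  map_top' := top_unique fun p _ => (rect ⊤ ⊤ : A ⊗ₗ B).1.lower (show p ≤ (⊤, ⊤) from le_top)
    (rect_le_iff.1 le_rfl)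
  map_sSup' S := by
    apply le_antisymm
    · rw [rect_le_iff]
      refine (sSup _ : A ⊗ₗ B).2.1 S ⊤ fun a ha => ?_
      exact rect_le_iff.1 (le_sSup ⟨a, ha, rfl⟩)
    · refine sSup_le ?_
      rintro _ ⟨a, ha, rfl⟩
      exact rect_le_iff.2 ((rect (sSup S) ⊤ : A ⊗ₗ B).1.lower
        (Prod.mk_le_mk.2 ⟨le_sSup ha, le_rfl⟩) (rect_le_iff.1 le_rfl))

/-- The inverse image map of the second product projection, `b ↦ ⊤ ⊕ b`. -/
def inr : FrameHom B (A ⊗ₗ B) where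
  toFun b := rect ⊤ b
  map_inf' a a' := by rw [rect_inf_rect, inf_idem]
  map_top' := top_unique fun p _ => (rect ⊤ ⊤ : A ⊗ₗ B).1.lower (show p ≤ (⊤, ⊤) from le_top)
    (rect_le_iff.1 le_rfl)
  map_sSup' S := by
    apply le_antisymm
    · rw [rect_le_iff]
      refine (sSup _ : A ⊗ₗ B).2.2 ⊤ S fun a ha => ?_
      exact rect_le_iff.1 (le_sSup ⟨a, ha, rfl⟩)
    · refine sSup_le ?_
      rintro _ ⟨a, ha, rfl⟩
      exact rect_le_iff.2 ((rect ⊤ (sSup S) : A ⊗ₗ B).1.lower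
        (Prod.mk_le_mk.2 ⟨le_rfl, le_sSup ha⟩) (rect_le_iff.1 le_rfl))

lemma inl_inf_inr (a : A) (b : B) : inl a ⊓ inr b = rect a b := by
  change rect a ⊤ ⊓ rect ⊤ b = _
  rw [rect_inf_rect, inf_top_eq, top_inf_eq]

lemma lift_inl (f : FrameHom A C) (g : FrameHom B C) : (lift f g).comp inl = f := by
  ext a
  change lift f g (rect a ⊤) = f a
  rw [lift_rect, map_top, inf_top_eq]

lemma lift_inr (f : FrameHom A C) (g : FrameHom B C) : (lift f g).comp inr = g := by
  ext b
  change lift f g (rect ⊤ b) = g b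
  rw [lift_rect, map_top, top_inf_eq]

lemma hom_ext {h k : FrameHom (A ⊗ₗ B) C} (hl : h.comp inl = k.comp inl)
    (hr : h.comp inr = k.comp inr) : h = k := by
  have key : ∀ a b, h (rect a b) = k (rect a b) := by
    intro a b
    rw [← inl_inf_inr, map_inf, map_inf]
    exact congrArg₂ (· ⊓ ·) (DFunLike.congr_fun hl a) (DFunLike.congr_fun hr b)
  ext G
  rw [eq_iSup_rect G]
  simp only [map_iSup, key]

/-- The inverse image map `(f × f)^*` of `f × f : X × X → Y × Y`, for a locale map `f : X → Y`
given by its inverse image map `f^* : A → B`. -/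
def prodMap (f : FrameHom A B) : FrameHom (A ⊗ₗ A) (B ⊗ₗ B) :=
  lift (inl.comp f) (inr.comp f)

variable (A) in
/-- The inverse image map of the diagonal `x ↦ (x, x)`. -/
def diag : FrameHom (A ⊗ₗ A) A := lift (FrameHom.id A) (FrameHom.id A)

variable (A) in
/-- The inverse image map of the exchange map `(x, y) ↦ (y, x)`. -/
def swap : FrameHom (A ⊗ₗ A) (A ⊗ₗ A) := lift inr inl

variable (A) in
/-- The inverse image map of `(x, y, z) ↦ (x, y)`. -/
def proj₁₂ : FrameHom (A ⊗ₗ A) (A ⊗ₗ A ⊗ₗ A) := lift inl (inr.comp inl)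

variable (A) in
/-- The inverse image map of `(x, y, z) ↦ (y, z)`. -/
def proj₂₃ : FrameHom (A ⊗ₗ A) (A ⊗ₗ A ⊗ₗ A) := inr

variable (A) in
/-- The inverse image map of `(x, y, z) ↦ (x, z)`. -/
def proj₁₃ : FrameHom (A ⊗ₗ A) (A ⊗ₗ A ⊗ₗ A) := lift inl (inr.comp inr)

end Product

/-! ### Positivity, overtness and relational composition -/

section Overt

variable {A B : Type*} [Frame A] [Frame B]

/-- `a > 0`: every cover of `a` is inhabited. -/
def IsPositive (a : A) : Prop := ∀ S : Set A, a ≤ sSup S → S.Nonempty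

/-- `a ≬ b`: the opens `a` and `b` meet. -/
def Meets (a b : A) : Prop := IsPositive (a ⊓ b)

variable (A) in
/-- A frame is overt if its positive elements form a base. -/
def IsOvertFrame : Prop := ∀ a : A, a = sSup {b | b ≤ a ∧ IsPositive b}

/-- The value at `b` of the left adjoint of the frame homomorphism `f`: the least `a` such that
`b ≤ f a`. -/
def leftAdj (f : FrameHom A B) (b : B) : A := sInf {a | b ≤ f a}

/-- The relational composite `F ∘ E = {(x, z) | ∃ y, (x, y) ∈ E ∧ (y, z) ∈ F}` of open relations
on an overt locale, where existential quantification over `y` is the left adjoint of the inverse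
image map of the projection `(x, y, z) ↦ (x, z)`. -/
def relComp (F E : A ⊗ₗ A) : A ⊗ₗ A := leftAdj (proj₁₃ A) (proj₁₂ A E ⊓ proj₂₃ A F)

end Overt

/-! ### Uniformities on an overt locale -/

section Uniformities

variable {A B : Type*} [Frame A] [Frame B]

/-- The axioms of an entourage uniformity for a filter of opens of `X × X`. -/
structure IsEntourageUniformity (𝓔 : PFilter (A ⊗ₗ A)) : Prop where
  refl : ∀ E ∈ 𝓔, diag A E = ⊤
  symm : ∀ E ∈ 𝓔, ∃ E' ∈ 𝓔, E = swap A E'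
  trans : ∀ E ∈ 𝓔, ∃ F ∈ 𝓔, relComp F F ≤ E

/-- The uniformly below relation defined by a filter of entourages. -/
def UnifBelowEnt (𝓔 : PFilter (A ⊗ₗ A)) (a b : A) : Prop :=
  ∃ E ∈ 𝓔, relComp E (rect a a) ≤ rect b b

variable (A) in
/-- Covering downsets, ordered by inclusion. -/
abbrev CoveringDownset : Type _ := {U : LowerSet A // sSup (U : Set A) = ⊤}

/-- A downset is strong if it is generated by its positive elements. -/
def IsStrong (U : LowerSet A) : Prop := U = lowerClosure {u | u ∈ U ∧ IsPositive u}

/-- The star `st(a, U)` of an open `a` with respect to a downset `U`. -/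
def star (a : A) (U : LowerSet A) : A := sSup {u | u ∈ U ∧ Meets a u}

/-- The downset `U^⋆` generated by the stars `st(u, U)` with `u ∈ U`. -/
def starDownset (U : LowerSet A) : LowerSet A := lowerClosure ((fun u => star u U) '' U)

/-- The star-refinement axiom of a covering uniformity for a filter of covering downsets. -/
structure IsCoveringUniformity (𝓤 : PFilter (CoveringDownset A)) : Prop where
  star_refine : ∀ U ∈ 𝓤, ∃ V ∈ 𝓤, IsStrong V.1 ∧ starDownset V.1 ≤ U.1

/-- The uniformly below relation defined by a filter of covering downsets. -/
def UnifBelowCov (𝓤 : PFilter (CoveringDownset A)) (a b : A) : Prop :=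
  ∃ U ∈ 𝓤, star a U.1 ≤ b

/-- The downset `↓ f^*[V]` for a covering downset `V`. -/
def CoveringDownset.pullback (f : FrameHom A B) (V : CoveringDownset A) : CoveringDownset B :=
  ⟨lowerClosure (f '' V.1), by
    refine top_unique ?_
    have h : f (sSup (V.1 : Set A)) = ⊤ := by rw [V.2, map_top]
    rw [← h, map_sSup]
    exact sSup_le_sSup subset_lowerClosure⟩

lemma CoveringDownset.pullback_id (V : CoveringDownset A) :
    V.pullback (FrameHom.id A) = V := by
  refine Subtype.ext (SetLike.coe_injective ?_)
  change (lowerClosure ((fun a : A => a) '' (V.1 : Set A)) : Set A) = V.1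
  rw [Set.image_id', V.1.lower.lowerClosure]

lemma CoveringDownset.pullback_comp {C : Type*} [Frame C] (f : FrameHom A B) (g : FrameHom B C)
    (V : CoveringDownset A) : V.pullback (g.comp f) = (V.pullback f).pullback g := by
  refine Subtype.ext (LowerSet.ext (Set.ext fun c => ?_))
  simp only [pullback, SetLike.mem_coe, mem_lowerClosure, Set.mem_image]
  constructor
  · rintro ⟨_, ⟨a, ha, rfl⟩, h⟩
    exact ⟨_, ⟨f a, ⟨_, ⟨a, ha, rfl⟩, le_rfl⟩, rfl⟩, h⟩
  · rintro ⟨_, ⟨b, ⟨_, ⟨a, ha, rfl⟩, hb⟩, rfl⟩, h⟩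
    exact ⟨_, ⟨a, ha, rfl⟩, h.trans (OrderHomClass.mono g hb)⟩

/-- The downset generated by the positive `u` with `u ⊕ u ≤ E`. -/
def hatDownset (E : A ⊗ₗ A) : LowerSet A := lowerClosure {u | IsPositive u ∧ rect u u ≤ E}

/-- The open relation `⋁ {u ⊕ u | u ∈ U}`. -/
def barRel (U : LowerSet A) : A ⊗ₗ A := ⨆ u ∈ U, rect u u

lemma prodMap_id : prodMap (FrameHom.id A) = FrameHom.id (A ⊗ₗ A) := by
  apply hom_ext
  · rw [prodMap, lift_inl]; rfl
  · rw [prodMap, lift_inr]; rfl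

lemma prodMap_comp {C : Type*} [Frame C] (f : FrameHom A B) (g : FrameHom B C) :
    prodMap (g.comp f) = (prodMap g).comp (prodMap f) := by
  have hl : (prodMap g).comp inl = inl.comp g := lift_inl _ _
  have hr : (prodMap g).comp inr = inr.comp g := lift_inr _ _
  apply hom_ext
  · rw [prodMap, lift_inl, FrameHom.comp_assoc, prodMap, prodMap, lift_inl, ← FrameHom.comp_assoc,
      ← FrameHom.comp_assoc, ← prodMap, hl]
  · rw [prodMap, lift_inr, FrameHom.comp_assoc, prodMap, prodMap, lift_inr, ← FrameHom.comp_assoc,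
      ← FrameHom.comp_assoc, ← prodMap, hr]

end Uniformities

/-! ### The categories -/

/-- The property of a locale of being overt. -/
def isOvert : ObjectProperty Locale.{u} := fun X => IsOvertFrame X

/-- The category of overt locales and locale maps. -/
abbrev OLoc : Type (u + 1) := isOvert.{u}.FullSubcategory

/-- The frame of opens of an overt locale. -/
abbrev Opens (X : OLoc.{u}) : Type u := X.obj

/-- The inverse image map `f^*` of a locale map `f`. -/
def invImage {X Y : OLoc.{u}} (f : X ⟶ Y) : FrameHom (Opens Y) (Opens X) :=
  Frm.Hom.hom (@Quiver.Hom.unop Frm.{u} _ X.obj Y.obj f.hom)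

lemma invImage_id (X : OLoc.{u}) : invImage (𝟙 X) = FrameHom.id (Opens X) := rfl

lemma invImage_comp {X Y Z : OLoc.{u}} (f : X ⟶ Y) (g : Y ⟶ Z) :
    invImage (f ≫ g) = (invImage f).comp (invImage g) := rfl

/-- Pre-uniform locales via entourages. -/
structure PUnifEnt : Type (u + 1) where
  /-- the underlying overt locale -/
  loc : OLoc.{u}
  /-- the filter of entourages -/
  unif : PFilter (Opens loc ⊗ₗ Opens loc)
  isUnif : IsEntourageUniformity unif

/-- Morphisms of pre-uniform locales via entourages. -/
@[ext]
structure PUnifEnt.Hom (X Y : PUnifEnt.{u}) : Type u where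
  /-- the underlying locale map -/
  map : X.loc ⟶ Y.loc
  pullback_mem : ∀ F ∈ Y.unif, prodMap (invImage map) F ∈ X.unif

instance : Category.{u} PUnifEnt.{u} where
  Hom := PUnifEnt.Hom
  id X := ⟨𝟙 X.loc, fun F hF => by rw [invImage_id, prodMap_id]; exact hF⟩
  comp f g := ⟨f.map ≫ g.map, fun F hF => by
    rw [invImage_comp, prodMap_comp]
    exact f.pullback_mem _ (g.pullback_mem _ hF)⟩

/-- The forgetful functor to overt locales. -/
def PUnifEnt.forget : PUnifEnt.{u} ⥤ OLoc.{u} where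
  obj X := X.loc
  map f := PUnifEnt.Hom.map f

/-- Pre-uniform locales via covers. -/
structure PUnifCov : Type (u + 1) where
  /-- the underlying overt locale -/
  loc : OLoc.{u}
  /-- the filter of uniform covering downsets -/
  unif : PFilter (CoveringDownset (Opens loc))
  isUnif : IsCoveringUniformity unif

/-- Morphisms of pre-uniform locales via covers. -/
@[ext]
structure PUnifCov.Hom (X Y : PUnifCov.{u}) : Type u where
  /-- the underlying locale map -/
  map : X.loc ⟶ Y.loc
  pullback_mem : ∀ V ∈ Y.unif, CoveringDownset.pullback (invImage map) V ∈ X.unif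

instance : Category.{u} PUnifCov.{u} where
  Hom := PUnifCov.Hom
  id X := ⟨𝟙 X.loc, fun V hV => by
    rw [invImage_id, CoveringDownset.pullback_id]; exact hV⟩
  comp f g := ⟨f.map ≫ g.map, fun V hV => by
    rw [invImage_comp, CoveringDownset.pullback_comp]
    exact f.pullback_mem _ (g.pullback_mem _ hV)⟩

/-- The forgetful functor to overt locales. -/
def PUnifCov.forget : PUnifCov.{u} ⥤ OLoc.{u} where
  obj X := X.loc
  map f := PUnifCov.Hom.map f

/-- A pre-uniform locale via entourages is uniform if each open is the join of the opens uniformly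
below it. -/
def isUniformEnt : ObjectProperty PUnifEnt.{u} :=
  fun X => ∀ b : Opens X.loc, b = sSup {a | UnifBelowEnt X.unif a b}

/-- A pre-uniform locale via covers is uniform if each open is the join of the opens uniformly
below it. -/
def isUniformCov : ObjectProperty PUnifCov.{u} :=
  fun X => ∀ b : Opens X.loc, b = sSup {a | UnifBelowCov X.unif a b}

/-- The category of uniform locales via entourages. -/
abbrev UnifEnt : Type (u + 1) := isUniformEnt.{u}.FullSubcategory

/-- The category of uniform locales via covers. -/
abbrev UnifCov : Type (u + 1) := isUniformCov.{u}.FullSubcategory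

end ULoc

end

/-! Call an open `u` small for `E` if `u ⊕ u ≤ E`. Passing from `E` to its positive small opens
(`hatDownset`) and from `U` to its union of squares (`barRel`) is nearly a Galois connection:
`barRel_hatDownset_le` always holds, and `le_hatDownset_barRel` holds for strong `U`. The opposite
inequalities hold up to a refinement that a uniformity absorbs: a reflexive `E` satisfies `E ⊓ swap
E ≤ barRel (hatDownset E)` (`inf_swap_le_barRel_hatDownset`), and `hatDownset (barRel U)` lies in
the double star of `U` (`hatDownset_barRel_le`). Hence the two filter constructions are mutually
inverse.

The axioms correspond because composing relations chains overlapping opens: a threefold composite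
below `E` yields a star refinement, and a star refinement yields a twofold composite. `barRel`
commutes with pullback along a locale map, and pullback does not enlarge stars, so both uniformities
have the same morphisms. Both functors keep the underlying map, so equality on objects and
faithfulness of the forgetful functors give an isomorphism of categories. -/

namespace ULoc

/-! ### Positivity and open rectangles. -/

section Rect

variable {A B : Type*} [Frame A] [Frame B]

lemma isPositive_iff {a : A} : IsPositive a ↔ a ≠ ⊥ := by
  constructor
  · rintro h rfl
    exact Set.not_nonempty_empty (h ∅ bot_le)
  · intro h S hS
    rw [Set.nonempty_iff_ne_empty]
    rintro rfl
    exact h (le_bot_iff.1 (hS.trans sSup_empty.le))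

lemma meets_iff {a b : A} : Meets a b ↔ a ⊓ b ≠ ⊥ := isPositive_iff

lemma Meets.symm {a b : A} (h : Meets a b) : Meets b a := by
  rwa [Meets, inf_comm]

lemma meets_self {a : A} : Meets a a ↔ IsPositive a := by rw [Meets, inf_idem]

lemma IsPositive.mono {a b : A} (h : IsPositive a) (hab : a ≤ b) : IsPositive b :=
  fun S hS => h S (hab.trans hS)

lemma Meets.mono {a b c d : A} (h : Meets a b) (hac : a ≤ c) (hbd : b ≤ d) : Meets c d :=
  IsPositive.mono h (inf_le_inf hac hbd)

lemma rect_mono {a a' : A} {b b' : B} (ha : a ≤ a') (hb : b ≤ b') : rect a b ≤ rect a' b' :=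
  rect_le_iff.2 ((rect a' b').1.lower (Prod.mk_le_mk.2 ⟨ha, hb⟩) (rect_le_iff.1 le_rfl))

lemma sSup_rect_le {S : Set A} {b : B} {G : A ⊗ₗ B} (h : ∀ a ∈ S, rect a b ≤ G) :
    rect (sSup S) b ≤ G :=
  rect_le_iff.2 (G.2.1 S b fun a ha => rect_le_iff.1 (h a ha))

lemma rect_sSup_le {a : A} {S : Set B} {G : A ⊗ₗ B} (h : ∀ b ∈ S, rect a b ≤ G) :
    rect a (sSup S) ≤ G :=
  rect_le_iff.2 (G.2.2 a S fun b hb => rect_le_iff.1 (h b hb))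

lemma rect_sup_sup_le {a b : A} {G : A ⊗ₗ A} (haa : rect a a ≤ G) (hab : rect a b ≤ G)
    (hba : rect b a ≤ G) (hbb : rect b b ≤ G) : rect (a ⊔ b) (a ⊔ b) ≤ G := by
  rw [← sSup_pair]
  refine sSup_rect_le fun x hx => rect_sSup_le fun y hy => ?_
  rcases hx with rfl | rfl <;> rcases hy with rfl | rfl <;> assumption

lemma rect_bot_left (b : B) : rect (⊥ : A) b = ⊥ := by
  rw [← sSup_empty]
  exact le_bot_iff.1 (sSup_rect_le (by simp))

lemma rect_bot_right (a : A) : rect a (⊥ : B) = ⊥ := by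
  rw [← sSup_empty]
  exact le_bot_iff.1 (rect_sSup_le (by simp))

/-- The pairs with first side `⊥` or second side below `b'` form an open containing the larger
rectangle; a positive first side leaves only the second alternative. -/
lemma rect_le_rect_right {a a' : A} {b b' : B} (ha : IsPositive a) (h : rect a b ≤ rect a' b') :
    b ≤ b' := by
  let L : LowerSet (A × B) := ⟨{p | p.1 = ⊥ ∨ p.2 ≤ b'}, fun p q hqp hp =>
    hp.imp (fun h => le_bot_iff.1 (hqp.1.trans_eq h)) fun h => hqp.2.trans h⟩
  have hL : L ∈ saturatedSublocale A B := by
    refine ⟨fun S b h => ?_, fun a S h => ?_⟩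
    · by_cases hb : b ≤ b'
      · exact Or.inr hb
      · exact Or.inl (sSup_eq_bot.2 fun x hx => (h x hx).resolve_right hb)
    · by_cases ha : a = ⊥
      · exact Or.inl ha
      · exact Or.inr (sSup_le fun x hx => (h x hx).resolve_left ha)
  have h' : rect a' b' ≤ (⟨L, hL⟩ : A ⊗ₗ B) := rect_le_iff.2 (Or.inr le_rfl)
  exact (rect_le_iff.1 (h.trans h')).resolve_left (isPositive_iff.1 ha)

lemma isPositive_rect {a : A} {b : B} (ha : IsPositive a) (hb : IsPositive b) :
    IsPositive (rect a b) := by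
  rw [isPositive_iff] at hb ⊢
  intro h
  refine hb (le_bot_iff.1 (rect_le_rect_right (a' := (⊥ : A)) ha ?_))
  rw [h]
  exact bot_le

end Rect

/-! ### Composition of open relations, computed on rectangles. -/

section Comp

variable {A : Type*} [Frame A]

lemma proj₁₂_rect (a b : A) : proj₁₂ A (rect a b) = rect a (rect b ⊤) := by
  rw [proj₁₂, lift_rect]
  change inl a ⊓ inr (inl b) = _
  rw [inl_inf_inr]
  rfl

lemma proj₂₃_rect (a b : A) : proj₂₃ A (rect a b) = rect ⊤ (rect a b) := rfl

lemma proj₁₃_rect (a b : A) : proj₁₃ A (rect a b) = rect a (rect ⊤ b) := by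
  rw [proj₁₃, lift_rect]
  change inl a ⊓ inr (inr b) = _
  rw [inl_inf_inr]
  rfl

lemma proj₁₂_rect_inf_proj₂₃_rect (a b c d : A) :
    proj₁₂ A (rect a b) ⊓ proj₂₃ A (rect c d) = rect a (rect (b ⊓ c) d) := by
  rw [proj₁₂_rect, proj₂₃_rect, rect_inf_rect, rect_inf_rect, inf_top_eq, top_inf_eq]

/-- The projection `(x, y, z) ↦ (x, z)` is open: it maps an open box with nonempty middle side to
the rectangle of the two outer sides. -/
lemma rect_le_of_rect_rect_le_proj₁₃ {a m c : A} (hm : IsPositive m) {G : A ⊗ₗ A}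
    (h : rect a (rect m c) ≤ proj₁₃ A G) : rect a c ≤ G := by
  -- `T x` consists of the boxes `y ⊕ z` with `x ⊕ (y ⊕ z)` visibly inside the preimage of `G`; `K`
  -- below assembles these slices into an open of the triple product that bounds the preimage.
  let T (x : A) : LowerSet (A × A) := ⟨{p | p.1 = ⊥ ∨ (x, p.2) ∈ G.1}, fun p q hqp hp =>
    hp.imp (fun h => le_bot_iff.1 (hqp.1.trans_eq h))
      fun h => G.1.lower (Prod.mk_le_mk.2 ⟨le_rfl, hqp.2⟩) h⟩
  have hT (x : A) : T x ∈ saturatedSublocale A A := by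
    refine ⟨fun S z h => ?_, fun y S h => ?_⟩
    · by_cases hz : (x, z) ∈ G.1
      · exact Or.inr hz
      · exact Or.inl (sSup_eq_bot.2 fun y hy => (h y hy).resolve_right hz)
    · by_cases hy : y = ⊥
      · exact Or.inl hy
      · exact Or.inr (G.2.2 x S fun z hz => (h z hz).resolve_left hy)
  let T' (x : A) : A ⊗ₗ A := ⟨T x, hT x⟩
  let K : LowerSet (A × (A ⊗ₗ A)) := ⟨{p | p.2 ≤ T' p.1}, fun p q hqp hp =>
    hqp.2.trans (le_trans (b := T' p.1) hp fun r (hr : r.1 = ⊥ ∨ (p.1, r.2) ∈ G.1) =>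
      hr.imp_right fun h => G.1.lower (Prod.mk_le_mk.2 ⟨hqp.1, le_rfl⟩) h)⟩
  have hK : K ∈ saturatedSublocale A (A ⊗ₗ A) := by
    refine ⟨fun S t h p hp => ?_, fun x S h => show sSup S ≤ T' x from sSup_le h⟩
    by_cases hp1 : p.1 = ⊥
    · exact Or.inl hp1
    · exact Or.inr (G.2.1 S p.2 fun x hx => (h x hx hp).resolve_left hp1)
  have hG : proj₁₃ A G ≤ (⟨K, hK⟩ : A ⊗ₗ A ⊗ₗ A) := by
    rw [proj₁₃, lift_apply]
    refine iSup₂_le fun p hp => ?_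
    change inl p.1 ⊓ inr (inr p.2) ≤ _
    rw [inl_inf_inr, rect_le_iff]
    exact rect_le_iff.2 (Or.inr hp)
  have h' : rect m c ≤ T' a := rect_le_iff.1 (h.trans hG)
  exact rect_le_iff.2 ((rect_le_iff.1 h').resolve_left (isPositive_iff.1 hm))

lemma rect_le_relComp {E F : A ⊗ₗ A} {a b c d : A} (hE : rect a b ≤ E) (hF : rect c d ≤ F)
    (h : Meets b c) : rect a d ≤ relComp F E := by
  refine le_sInf fun G hG => rect_le_of_rect_rect_le_proj₁₃ h (le_trans ?_ hG)
  rw [← proj₁₂_rect_inf_proj₂₃_rect]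
  exact inf_le_inf (OrderHomClass.mono _ hE) (OrderHomClass.mono _ hF)

lemma relComp_mono {E E' F F' : A ⊗ₗ A} (hE : E ≤ E') (hF : F ≤ F') :
    relComp F E ≤ relComp F' E' :=
  sInf_le_sInf fun G (hG : proj₁₂ A E' ⊓ proj₂₃ A F' ≤ proj₁₃ A G) =>
    show proj₁₂ A E ⊓ proj₂₃ A F ≤ proj₁₃ A G from
      (inf_le_inf (OrderHomClass.mono _ hE) (OrderHomClass.mono _ hF)).trans hG

/-- Meets distribute over joins, so only pairs of rectangles matter, and a pair whose middle sides
do not meet contributes `⊥`. -/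
lemma relComp_iSup_rect_le {ι κ : Sort*} {a b : ι → A} {c d : κ → A} {G : A ⊗ₗ A}
    (h : ∀ i j, Meets (b i) (c j) → rect (a i) (d j) ≤ G) :
    relComp (⨆ j, rect (c j) (d j)) (⨆ i, rect (a i) (b i)) ≤ G := by
  refine sInf_le (show proj₁₂ A _ ⊓ proj₂₃ A _ ≤ proj₁₃ A G from ?_)
  rw [map_iSup, map_iSup, iSup_inf_eq]
  refine iSup_le fun i => ?_
  rw [inf_iSup_eq]
  refine iSup_le fun j => ?_
  rw [proj₁₂_rect_inf_proj₂₃_rect]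
  by_cases hij : b i ⊓ c j = ⊥
  · rw [hij, rect_bot_left, rect_bot_right]
    exact bot_le
  · refine le_trans ?_ (OrderHomClass.mono (proj₁₃ A) (h i j (meets_iff.2 hij)))
    rw [proj₁₃_rect]
    exact rect_mono le_rfl (rect_mono le_top le_rfl)

lemma diag_rect (a b : A) : diag A (rect a b) = a ⊓ b := by
  rw [diag, lift_rect]
  rfl

lemma swap_rect (a b : A) : swap A (rect a b) = rect b a := by
  rw [swap, lift_rect, inf_comm, inl_inf_inr]

lemma swap_swap (E : A ⊗ₗ A) : swap A (swap A E) = E := by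
  conv_rhs => rw [eq_iSup_rect E]
  conv_lhs => rw [eq_iSup_rect E]
  simp only [map_iSup, swap_rect]

lemma prodMap_rect {B : Type*} [Frame B] (f : FrameHom A B) (a b : A) :
    prodMap f (rect a b) = rect (f a) (f b) := by
  rw [prodMap, lift_rect]
  exact inl_inf_inr _ _

end Comp

/-! ### Passage between relations and downsets, and star estimates. -/

section Downsets

variable {A B : Type*} [Frame A] [Frame B]

lemma mem_hatDownset {E : A ⊗ₗ A} {a : A} :
    a ∈ hatDownset E ↔ ∃ u, (IsPositive u ∧ rect u u ≤ E) ∧ a ≤ u := mem_lowerClosure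

lemma IsPositive.mem_hatDownset {E : A ⊗ₗ A} {a : A} (ha : IsPositive a) (h : rect a a ≤ E) :
    a ∈ hatDownset E := subset_lowerClosure ⟨ha, h⟩

lemma rect_le_of_mem_hatDownset {E : A ⊗ₗ A} {a : A} (h : a ∈ hatDownset E) : rect a a ≤ E := by
  obtain ⟨u, ⟨-, hu⟩, hau⟩ := ULoc.mem_hatDownset.1 h
  exact (rect_mono hau hau).trans hu

lemma hatDownset_mono {E F : A ⊗ₗ A} (h : E ≤ F) : hatDownset E ≤ hatDownset F :=
  lowerClosure_mono fun _ hu => ⟨hu.1, hu.2.trans h⟩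

lemma isStrong_iff {U : LowerSet A} : IsStrong U ↔ ∀ a ∈ U, ∃ u ∈ U, IsPositive u ∧ a ≤ u := by
  constructor
  · intro h a ha
    rw [h] at ha
    obtain ⟨u, hu, hau⟩ := mem_lowerClosure.1 ha
    exact ⟨u, hu.1, hu.2, hau⟩
  · intro h
    refine le_antisymm (fun a ha => ?_) (lowerClosure_le.2 fun u hu => hu.1)
    obtain ⟨u, hu, hu', hau⟩ := h a ha
    exact mem_lowerClosure.2 ⟨u, ⟨hu, hu'⟩, hau⟩

lemma isStrong_hatDownset (E : A ⊗ₗ A) : IsStrong (hatDownset E) := by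
  rw [isStrong_iff]
  intro a ha
  obtain ⟨u, hu, hau⟩ := mem_hatDownset.1 ha
  exact ⟨u, hu.1.mem_hatDownset hu.2, hu.1, hau⟩

/-- Reflexivity says that the opens `a ⊓ b` with `a ⊕ b ≤ E` cover, and each of them that is nonzero
is small for `E`. -/
lemma sSup_hatDownset {E : A ⊗ₗ A} (hE : diag A E = ⊤) :
    sSup (hatDownset E : Set A) = ⊤ := by
  rw [eq_top_iff, ← hE, diag, lift_apply]
  refine iSup₂_le fun p hp => ?_
  change p.1 ⊓ p.2 ≤ _
  by_cases h : p.1 ⊓ p.2 = ⊥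
  · rw [h]
    exact bot_le
  · exact le_sSup ((isPositive_iff.2 h).mem_hatDownset
      ((rect_mono inf_le_left inf_le_right).trans (rect_le_iff.2 hp)))

lemma rect_le_barRel {U : LowerSet A} {u : A} (hu : u ∈ U) : rect u u ≤ barRel U :=
  le_iSup₂_of_le u hu le_rfl

lemma barRel_mono {U V : LowerSet A} (h : U ≤ V) : barRel U ≤ barRel V :=
  iSup₂_le fun _ hu => rect_le_barRel (h hu)

lemma barRel_eq_iSup (U : LowerSet A) : barRel U = ⨆ u : U, rect u.1 u.1 := by
  rw [barRel, iSup_subtype']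

lemma barRel_hatDownset_le (E : A ⊗ₗ A) : barRel (hatDownset E) ≤ E :=
  iSup₂_le fun _ hu => rect_le_of_mem_hatDownset hu

lemma diag_barRel {U : LowerSet A} (hU : sSup (U : Set A) = ⊤) : diag A (barRel U) = ⊤ := by
  simp only [barRel, map_iSup, diag_rect, inf_idem]
  rw [← hU, sSup_eq_iSup]
  rfl

lemma swap_barRel (U : LowerSet A) : swap A (barRel U) = barRel U := by
  simp only [barRel, map_iSup, swap_rect]

lemma le_hatDownset_barRel {U : LowerSet A} (hU : IsStrong U) : U ≤ hatDownset (barRel U) := by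
  intro a ha
  obtain ⟨u, hu, hu', hau⟩ := isStrong_iff.1 hU a ha
  exact mem_hatDownset.2 ⟨u, ⟨hu', rect_le_barRel hu⟩, hau⟩

lemma prodMap_barRel (f : FrameHom A B) (U : CoveringDownset A) :
    prodMap f (barRel U.1) = barRel (U.pullback f).1 := by
  apply le_antisymm
  · simp only [barRel, map_iSup, prodMap_rect]
    exact iSup₂_le fun u hu =>
      rect_le_barRel (U := (U.pullback f).1) (subset_lowerClosure ⟨u, hu, rfl⟩)
  · refine iSup₂_le fun v hv => ?_
    obtain ⟨_, ⟨u, hu, rfl⟩, hvu⟩ := mem_lowerClosure.1 hv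
    refine (rect_mono hvu hvu).trans ?_
    rw [← prodMap_rect]
    exact OrderHomClass.mono _ (rect_le_barRel hu)

lemma pullback_mono (f : FrameHom A B) {U V : CoveringDownset A} (h : U ≤ V) :
    U.pullback f ≤ V.pullback f :=
  lowerClosure_mono (Set.image_mono h)

lemma le_star {a u : A} {U : LowerSet A} (hu : u ∈ U) (h : Meets a u) : u ≤ star a U :=
  le_sSup ⟨hu, h⟩

lemma star_mono {a b : A} {U V : LowerSet A} (hab : a ≤ b) (hUV : U ≤ V) :
    star a U ≤ star b V :=
  sSup_le fun _ hu => le_star (hUV hu.1) (hu.2.mono hab le_rfl)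

lemma le_star_self {a : A} {U : LowerSet A} (hU : sSup (U : Set A) = ⊤) : a ≤ star a U := by
  refine (le_inf le_rfl (le_top.trans hU.ge)).trans ?_
  rw [inf_sSup_eq]
  refine iSup₂_le fun u hu => ?_
  by_cases h : a ⊓ u = ⊥
  · rw [h]
    exact bot_le
  · exact inf_le_right.trans (le_star hu (meets_iff.2 h))

lemma star_mem_starDownset {u : A} {U : LowerSet A} (hu : u ∈ U) : star u U ∈ starDownset U :=
  subset_lowerClosure ⟨u, hu, rfl⟩

lemma starDownset_le {U V : LowerSet A} : starDownset U ≤ V ↔ ∀ u ∈ U, star u U ∈ V := by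
  rw [starDownset, lowerClosure_le, Set.image_subset_iff]
  rfl

lemma starDownset_mono {U V : LowerSet A} (h : U ≤ V) : starDownset U ≤ starDownset V :=
  starDownset_le.2 fun _ hu =>
    (starDownset V).lower (star_mono le_rfl h) (star_mem_starDownset (h hu))

lemma le_starDownset {U : LowerSet A} (hU : sSup (U : Set A) = ⊤) : U ≤ starDownset U :=
  fun _ hu => (starDownset U).lower (le_star_self hU) (star_mem_starDownset hu)

/-- The covering downset `U^⋆`. -/
def CoveringDownset.starred (U : CoveringDownset A) : CoveringDownset A :=
  ⟨starDownset U.1, top_unique (U.2.ge.trans (sSup_le_sSup (le_starDownset U.2)))⟩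

/-- Any two opens meeting `u` are joined by one member of `U`, because the positive rectangle they
cut out of `u ⊕ u` is covered by squares from `U`. Fix `v` in `U` meeting `u`. Each `x` in `U`
meeting `u` is then linked to `v` through some `w`, so `x ≤ star w U`, which meets `star v U`. The
intermediate `w` is what costs the second star. -/
lemma hatDownset_barRel_le (U : CoveringDownset A) :
    hatDownset (barRel U.1) ≤ starDownset (starDownset U.1) := by
  refine lowerClosure_le.2 fun u ⟨hu, huU⟩ => ?_
  have link {x y : A} (hx : Meets u x) (hy : Meets u y) : ∃ w ∈ U.1, Meets x w ∧ Meets w y := by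
    have h : rect (u ⊓ x) (u ⊓ y) ≤ ⨆ w ∈ U.1, rect (u ⊓ x ⊓ w) (u ⊓ y ⊓ w) := by
      refine (le_inf le_rfl
        ((rect_mono inf_le_left inf_le_left).trans huU)).trans ?_
      simp only [barRel, inf_iSup_eq, rect_inf_rect, le_refl]
    by_contra! hw
    refine isPositive_iff.1 (isPositive_rect hx hy) (le_bot_iff.1 (h.trans ?_))
    refine iSup₂_le fun w hwU => ?_
    by_cases hxw : u ⊓ x ⊓ w = ⊥
    · rw [hxw, rect_bot_left]
    by_cases hyw : u ⊓ y ⊓ w = ⊥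
    · rw [hyw, rect_bot_right]
    · exact absurd ((meets_iff.2 hyw).symm.mono le_rfl inf_le_right)
        (hw w hwU ((meets_iff.2 hxw).mono inf_le_right le_rfl))
  obtain ⟨v, hv⟩ : {v | v ∈ U.1 ∧ Meets u v}.Nonempty := hu _ (le_star_self U.2)
  refine (starDownset (starDownset U.1)).lower ?_
    (star_mem_starDownset (star_mem_starDownset hv.1))
  refine (le_star_self U.2).trans (sSup_le fun x hx => ?_)
  obtain ⟨w, hw, hvw, hwx⟩ := link hv.2 hx.2
  refine (le_star hx.1 hwx).trans (le_star (star_mem_starDownset hw) ?_)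
  exact (meets_self.2 (IsPositive.mono hvw inf_le_right)).mono (le_star hw hvw) (le_star_self U.2)

/-- Since `f` preserves binary meets and `⊥`, opens whose inverse images meet must themselves meet.
-/
lemma starDownset_pullback_le (f : FrameHom A B) (U : CoveringDownset A) :
    (U.pullback f).starred ≤ U.starred.pullback f := by
  refine starDownset_le.2 fun b hb => ?_
  obtain ⟨_, ⟨u, hu, rfl⟩, hbu⟩ := mem_lowerClosure.1 hb
  refine mem_lowerClosure.2 ⟨f (star u U.1), ⟨_, star_mem_starDownset hu, rfl⟩, ?_⟩
  refine sSup_le fun c hc => ?_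
  obtain ⟨_, ⟨v, hv, rfl⟩, hcv⟩ := mem_lowerClosure.1 hc.1
  refine hcv.trans (OrderHomClass.mono f (le_star hv (meets_iff.2 fun h => ?_)))
  refine meets_iff.1 (hc.2.mono hbu hcv) ?_
  rw [← map_inf, h, map_bot]

/-- For `a ⊕ b` below both relations, `a` and `b` need not be small, so each is first cut by the
cover of small opens. For pieces `a ⊓ x` and `b ⊓ y`, the square of their join has four blocks: the
diagonal ones lie in `E` by smallness of `x` and `y`, the others by the bounds on `a ⊕ b` and `b ⊕
a`. -/
lemma inf_swap_le_barRel_hatDownset {E : A ⊗ₗ A} (hE : diag A E = ⊤) :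
    E ⊓ swap A E ≤ barRel (hatDownset E) := by
  rw [eq_iSup_rect (E ⊓ swap A E)]
  refine iSup₂_le fun p hp => ?_
  have hab : rect p.1 p.2 ≤ E ⊓ swap A E := rect_le_iff.2 hp
  have hba : rect p.2 p.1 ≤ E := by
    have := OrderHomClass.mono (swap A) (hab.trans inf_le_right)
    rwa [swap_rect, swap_swap] at this
  have cover (a : A) : a = sSup ((a ⊓ ·) '' (hatDownset E : Set A)) := by
    rw [sSup_image, ← inf_sSup_eq, sSup_hatDownset hE, inf_top_eq]
  rw [cover p.1, cover p.2]
  refine sSup_rect_le ?_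
  rintro _ ⟨x, hx, rfl⟩
  refine rect_sSup_le ?_
  rintro _ ⟨y, hy, rfl⟩
  dsimp only
  by_cases h : p.1 ⊓ x = ⊥
  · rw [h, rect_bot_left]
    exact bot_le
  · refine (rect_mono le_sup_left le_sup_right).trans (rect_le_barRel (IsPositive.mem_hatDownset
      ((isPositive_iff.2 h).mono le_sup_left) (rect_sup_sup_le ?_ ?_ ?_ ?_)))
    · exact (rect_mono inf_le_right inf_le_right).trans (rect_le_of_mem_hatDownset hx)
    · exact (rect_mono inf_le_left inf_le_left).trans (hab.trans inf_le_left)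
    · exact (rect_mono inf_le_left inf_le_left).trans hba
    · exact (rect_mono inf_le_right inf_le_right).trans (rect_le_of_mem_hatDownset hy)

end Downsets

/-! ### The bijection of uniformities, uniform maps and the uniformly below relation. -/

section Correspondence

variable {A B : Type*} [Frame A] [Frame B]

lemma exists_mem_le_le {P : Type*} [Preorder P] {F : PFilter P} {x y : P} (hx : x ∈ F)
    (hy : y ∈ F) : ∃ z ∈ F, z ≤ x ∧ z ≤ y :=
  F.directed x hx y hy

/-- The covering downset generated by the positive `u` with `u ⊕ u ≤ E`, for a reflexive `E`. -/
def hatCovering (E : A ⊗ₗ A) (hE : diag A E = ⊤) : CoveringDownset A :=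
  ⟨hatDownset E, sSup_hatDownset hE⟩

lemma le_relComp_of_diag {E F : A ⊗ₗ A} (hF : diag A F = ⊤) :
    E ≤ relComp F E := by
  rw [eq_iSup_rect E]
  refine iSup₂_le fun p hp => ?_
  -- The expansion of `E` also rewrote the right-hand side; this folds it back.
  rw [← eq_iSup_rect E]
  have cover : p.2 = sSup ((p.2 ⊓ ·) '' (hatDownset F : Set A)) := by
    rw [sSup_image, ← inf_sSup_eq, sSup_hatDownset hF, inf_top_eq]
  rw [cover]
  refine rect_sSup_le ?_
  rintro _ ⟨u, hu, rfl⟩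
  dsimp only
  by_cases h : p.2 ⊓ u = ⊥
  · rw [h, rect_bot_right]
    exact bot_le
  · have hu' : rect (p.2 ⊓ u) (p.2 ⊓ u) ≤ F :=
      (rect_mono inf_le_right inf_le_right).trans (rect_le_of_mem_hatDownset hu)
    refine rect_le_relComp (rect_le_iff.2 hp) hu' ?_
    rw [meets_iff, ← inf_assoc, inf_idem]
    exact h

/-- If `u` and `v` in `V` meet, then both lie below `star u V`, so `u ⊕ v` is inside a square from
`U`. -/
lemma relComp_barRel_le {U V : LowerSet A} (hVU : starDownset V ≤ U) :
    relComp (barRel V) (barRel V) ≤ barRel U := by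
  rw [barRel_eq_iSup V]
  refine relComp_iSup_rect_le fun u v huv => ?_
  refine (rect_mono (le_star u.2 (meets_self.2 ?_)) (le_star v.2 huv)).trans
    (rect_le_barRel (hVU (star_mem_starDownset u.2)))
  exact IsPositive.mono huv inf_le_left

namespace IsEntourageUniformity

variable {𝓔 : PFilter (A ⊗ₗ A)}

lemma exists_triple_relComp_le (h𝓔 : IsEntourageUniformity 𝓔) {E : A ⊗ₗ A} (hE : E ∈ 𝓔) :
    ∃ F ∈ 𝓔, relComp F (relComp F F) ≤ E := by
  obtain ⟨G, hG, hGE⟩ := h𝓔.trans E hE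
  obtain ⟨F, hF, hFG⟩ := h𝓔.trans G hG
  exact ⟨F, hF, (relComp_mono hFG ((le_relComp_of_diag (h𝓔.refl F hF)).trans hFG)).trans hGE⟩

lemma exists_starDownset_hatDownset_le (h𝓔 : IsEntourageUniformity 𝓔) {E : A ⊗ₗ A} (hE : E ∈ 𝓔) :
    ∃ F ∈ 𝓔, starDownset (hatDownset F) ≤ hatDownset E := by
  obtain ⟨F, hF, hFE⟩ := exists_triple_relComp_le h𝓔 hE
  refine ⟨F, hF, starDownset_le.2 fun a ha => ?_⟩
  obtain ⟨u, hu, hau⟩ := mem_hatDownset.1 ha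
  have huF := hu.1.mem_hatDownset hu.2
  refine mem_hatDownset.2 ⟨star u (hatDownset F), ⟨hu.1.mono (le_star huF (meets_self.2 hu.1)), ?_⟩,
    star_mono hau le_rfl⟩
  refine le_trans (sSup_rect_le fun v hv => rect_sSup_le fun w hw => ?_) hFE
  -- Chain `v ⊕ v`, `u ⊕ u`, `w ⊕ w`: one factor `F` for each, which is why three are needed.
  exact rect_le_relComp (rect_le_relComp (rect_le_of_mem_hatDownset hv.1) hu.2 hv.2.symm)
    (rect_le_of_mem_hatDownset hw.1) hw.2

/-- The filter of covering downsets with base the downsets `hatDownset E` for entourages `E`. -/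
def covFilter (h𝓔 : IsEntourageUniformity 𝓔) : PFilter (CoveringDownset A) :=
  IsPFilter.toPFilter (F := {U : CoveringDownset A | ∃ E ∈ 𝓔, hatDownset E ≤ U.1}) <| by
    refine IsPFilter.of_def ?_ ?_ ?_
    · obtain ⟨E, hE⟩ := 𝓔.nonempty
      exact ⟨hatCovering E (h𝓔.refl E hE), E, hE, le_rfl⟩
    · rintro U ⟨E, hE, hEU⟩ V ⟨F, hF, hFV⟩
      obtain ⟨G, hG, hGE, hGF⟩ := exists_mem_le_le hE hF
      exact ⟨hatCovering G (h𝓔.refl G hG), ⟨G, hG, le_rfl⟩,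
        (hatDownset_mono hGE).trans hEU, (hatDownset_mono hGF).trans hFV⟩
    · rintro U V hUV ⟨E, hE, hEU⟩
      exact ⟨E, hE, hEU.trans hUV⟩

lemma hatCovering_mem (h𝓔 : IsEntourageUniformity 𝓔) {E : A ⊗ₗ A} (hE : E ∈ 𝓔) :
    hatCovering E (h𝓔.refl E hE) ∈ h𝓔.covFilter := ⟨E, hE, le_rfl⟩

lemma isCoveringUniformity_covFilter (h𝓔 : IsEntourageUniformity 𝓔) :
    IsCoveringUniformity h𝓔.covFilter where
  star_refine := by
    rintro U ⟨E, hE, hEU⟩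
    obtain ⟨F, hF, hFE⟩ := exists_starDownset_hatDownset_le h𝓔 hE
    exact ⟨_, hatCovering_mem h𝓔 hF, isStrong_hatDownset F, hFE.trans hEU⟩

lemma barRel_hatDownset_mem (h𝓔 : IsEntourageUniformity 𝓔) {E : A ⊗ₗ A} (hE : E ∈ 𝓔) :
    barRel (hatDownset E) ∈ 𝓔 := by
  obtain ⟨E', hE', rfl⟩ := h𝓔.symm E hE
  obtain ⟨F, hF, hFE, hFE'⟩ := exists_mem_le_le hE hE'
  refine PFilter.mem_of_le ((le_inf hFE ?_).trans (inf_swap_le_barRel_hatDownset (h𝓔.refl _ hE))) hF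
  rwa [swap_swap]

lemma mem_iff_exists_barRel_le (h𝓔 : IsEntourageUniformity 𝓔) {E : A ⊗ₗ A} :
    E ∈ 𝓔 ↔ ∃ U ∈ h𝓔.covFilter, IsStrong U.1 ∧ barRel U.1 ≤ E := by
  constructor
  · intro hE
    exact ⟨_, hatCovering_mem h𝓔 hE, isStrong_hatDownset E, barRel_hatDownset_le E⟩
  · rintro ⟨U, ⟨F, hF, hFU⟩, -, hUE⟩
    exact PFilter.mem_of_le ((barRel_mono hFU).trans hUE) (barRel_hatDownset_mem h𝓔 hF)

end IsEntourageUniformity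

namespace IsCoveringUniformity

variable {𝓤 : PFilter (CoveringDownset A)}

lemma exists_strong_le (h𝓤 : IsCoveringUniformity 𝓤) {U : CoveringDownset A} (hU : U ∈ 𝓤) :
    ∃ V ∈ 𝓤, IsStrong V.1 ∧ V ≤ U := by
  obtain ⟨V, hV, hVs, hVU⟩ := h𝓤.star_refine U hU
  exact ⟨V, hV, hVs, (le_starDownset V.2).trans hVU⟩

lemma exists_starDownset_starDownset_le (h𝓤 : IsCoveringUniformity 𝓤)
    {U : CoveringDownset A} (hU : U ∈ 𝓤) :
    ∃ V ∈ 𝓤, IsStrong V.1 ∧ starDownset (starDownset V.1) ≤ U.1 := by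
  obtain ⟨W, hW, -, hWU⟩ := h𝓤.star_refine U hU
  obtain ⟨V, hV, hVs, hVW⟩ := h𝓤.star_refine W hW
  exact ⟨V, hV, hVs, (starDownset_mono hVW).trans hWU⟩

/-- The filter of open relations with base the `barRel U` for strong uniform `U`. -/
def entFilter (h𝓤 : IsCoveringUniformity 𝓤) : PFilter (A ⊗ₗ A) :=
  IsPFilter.toPFilter (F := {E : A ⊗ₗ A | ∃ U ∈ 𝓤, IsStrong U.1 ∧ barRel U.1 ≤ E}) <| by
    refine IsPFilter.of_def ?_ ?_ ?_
    · obtain ⟨U, hU⟩ := 𝓤.nonempty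
      obtain ⟨V, hV, hVs, -⟩ := exists_strong_le h𝓤 hU
      exact ⟨_, V, hV, hVs, le_rfl⟩
    · rintro E ⟨U, hU, -, hUE⟩ F ⟨V, hV, -, hVF⟩
      obtain ⟨W, hW, hWU, hWV⟩ := exists_mem_le_le hU hV
      obtain ⟨T, hT, hTs, hTW⟩ := exists_strong_le h𝓤 hW
      exact ⟨_, ⟨T, hT, hTs, le_rfl⟩, (barRel_mono (hTW.trans hWU)).trans hUE,
        (barRel_mono (hTW.trans hWV)).trans hVF⟩
    · rintro E F hEF ⟨U, hU, hUs, hUE⟩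
      exact ⟨U, hU, hUs, hUE.trans hEF⟩

lemma isEntourageUniformity_entFilter (h𝓤 : IsCoveringUniformity 𝓤) :
    IsEntourageUniformity h𝓤.entFilter where
  refl := by
    rintro E ⟨U, -, -, hUE⟩
    rw [eq_top_iff, ← diag_barRel U.2]
    exact OrderHomClass.mono _ hUE
  symm := by
    rintro E ⟨U, hU, hUs, hUE⟩
    refine ⟨swap A E, ⟨U, hU, hUs, ?_⟩, (swap_swap E).symm⟩
    rw [← swap_barRel]
    exact OrderHomClass.mono _ hUE
  trans := by
    rintro E ⟨U, hU, -, hUE⟩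
    obtain ⟨V, hV, hVs, hVU⟩ := h𝓤.star_refine U hU
    exact ⟨_, ⟨V, hV, hVs, le_rfl⟩, (relComp_barRel_le hVU).trans hUE⟩

lemma mem_iff_exists_hatDownset_le (h𝓤 : IsCoveringUniformity 𝓤) {U : CoveringDownset A} :
    U ∈ 𝓤 ↔ ∃ E ∈ h𝓤.entFilter, hatDownset E ≤ U.1 := by
  constructor
  · intro hU
    obtain ⟨V, hV, hVs, hVU⟩ := exists_starDownset_starDownset_le h𝓤 hU
    exact ⟨_, ⟨V, hV, hVs, le_rfl⟩, (hatDownset_barRel_le V).trans hVU⟩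
  · rintro ⟨E, ⟨V, hV, hVs, hVE⟩, hEU⟩
    exact PFilter.mem_of_le (show V ≤ U from
      (le_hatDownset_barRel hVs).trans ((hatDownset_mono hVE).trans hEU)) hV

end IsCoveringUniformity

lemma entFilter_covFilter {𝓔 : PFilter (A ⊗ₗ A)} (h𝓔 : IsEntourageUniformity 𝓔) :
    h𝓔.isCoveringUniformity_covFilter.entFilter = 𝓔 :=
  SetLike.ext fun _ => h𝓔.mem_iff_exists_barRel_le.symm

lemma covFilter_entFilter {𝓤 : PFilter (CoveringDownset A)} (h𝓤 : IsCoveringUniformity 𝓤) :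
    h𝓤.isEntourageUniformity_entFilter.covFilter = 𝓤 :=
  SetLike.ext fun _ => h𝓤.mem_iff_exists_hatDownset_le.symm

lemma IsEntourageUniformity.unifBelow_iff {𝓔 : PFilter (A ⊗ₗ A)} (h𝓔 : IsEntourageUniformity 𝓔)
    {a b : A} : UnifBelowEnt 𝓔 a b ↔ UnifBelowCov h𝓔.covFilter a b := by
  constructor
  · rintro ⟨E, hE, h⟩
    refine ⟨_, h𝓔.hatCovering_mem hE, sSup_le fun u hu => ?_⟩
    -- `a ⊕ u` lies in the composite, hence in `b ⊕ b`; `a` is positive because it meets `u`, so it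
    -- can be cancelled.
    exact rect_le_rect_right (IsPositive.mono hu.2 inf_le_left)
      ((rect_le_relComp le_rfl (rect_le_of_mem_hatDownset hu.1) hu.2).trans h)
  · rintro ⟨U, ⟨E, hE, hEU⟩, h⟩
    refine ⟨_, h𝓔.barRel_hatDownset_mem hE, ?_⟩
    -- The single rectangle becomes a one-term join, to fit `relComp_iSup_rect_le`.
    rw [barRel_eq_iSup, ← iSup_const (ι := Unit) (a := rect a a)]
    refine relComp_iSup_rect_le fun _ u hu => rect_mono ((le_star_self U.2).trans h) ?_
    exact (le_star (hEU u.2) hu).trans h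

/-- For covers, choose `V` whose double star refines `U`: the small opens for the pulled-back
`barRel V` lie in the double star of the pullback of `V`, hence in the pullback of `U`. For
entourages, `prodMap_barRel` applied to `hatDownset E` suffices. -/
lemma prodMap_mem_iff {𝓔 : PFilter (A ⊗ₗ A)} (h𝓔 : IsEntourageUniformity 𝓔)
    {𝓕 : PFilter (B ⊗ₗ B)} (h𝓕 : IsEntourageUniformity 𝓕) (f : FrameHom A B) :
    (∀ E ∈ 𝓔, prodMap f E ∈ 𝓕) ↔ ∀ U ∈ h𝓔.covFilter, U.pullback f ∈ h𝓕.covFilter := by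
  constructor
  · intro h U hU
    obtain ⟨V, hV, hVs, hVU⟩ :=
      h𝓔.isCoveringUniformity_covFilter.exists_starDownset_starDownset_le hU
    refine ⟨prodMap f (barRel V.1), h _ (h𝓔.mem_iff_exists_barRel_le.2 ⟨V, hV, hVs, le_rfl⟩), ?_⟩
    rw [prodMap_barRel]
    refine (hatDownset_barRel_le _).trans ?_
    refine (starDownset_mono (starDownset_pullback_le f V)).trans ?_
    exact (starDownset_pullback_le f V.starred).trans (pullback_mono f (U := V.starred.starred) hVU)
  · intro h E hE
    obtain ⟨F, hF, hFE⟩ := h _ (h𝓔.hatCovering_mem hE)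
    refine PFilter.mem_of_le ?_ (h𝓕.barRel_hatDownset_mem hF)
    refine (barRel_mono hFE).trans ((prodMap_barRel f (hatCovering E _)).ge.trans ?_)
    exact OrderHomClass.mono _ (barRel_hatDownset_le E)

end Correspondence

/-! ### The isomorphism of categories and its restriction to uniform locales. -/

section Functors

/-- The functor from pre-uniform locales via entourages to pre-uniform locales via covers. -/
def entToCov : PUnifEnt.{u} ⥤ PUnifCov.{u} where
  obj X := ⟨X.loc, X.isUnif.covFilter, X.isUnif.isCoveringUniformity_covFilter⟩
  map {X Y} f := ⟨PUnifEnt.Hom.map f,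
    (prodMap_mem_iff Y.isUnif X.isUnif _).1 (PUnifEnt.Hom.pullback_mem f)⟩

/-- The functor from pre-uniform locales via covers to pre-uniform locales via entourages. -/
def covToEnt : PUnifCov.{u} ⥤ PUnifEnt.{u} where
  obj X := ⟨X.loc, X.isUnif.entFilter, X.isUnif.isEntourageUniformity_entFilter⟩
  map {X Y} f := ⟨PUnifCov.Hom.map f, by
    -- Every covering uniformity is recovered from its entourages, so the entourage form of the
    -- morphism criterion covers this direction too.
    rw [prodMap_mem_iff Y.isUnif.isEntourageUniformity_entFilter
      X.isUnif.isEntourageUniformity_entFilter, covFilter_entFilter, covFilter_entFilter]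
    exact PUnifCov.Hom.pullback_mem f⟩

lemma PUnifEnt.ext_unif {X Y : PUnifEnt.{u}} (hloc : X.loc = Y.loc) (h : HEq X.unif Y.unif) :
    X = Y := by
  cases X; cases Y; cases hloc; cases h; rfl

lemma PUnifCov.ext_unif {X Y : PUnifCov.{u}} (hloc : X.loc = Y.loc) (h : HEq X.unif Y.unif) :
    X = Y := by
  cases X; cases Y; cases hloc; cases h; rfl

instance : PUnifEnt.forget.{u}.Faithful where
  map_injective h := PUnifEnt.Hom.ext h

instance : PUnifCov.forget.{u}.Faithful where
  map_injective h := PUnifCov.Hom.ext h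

/-- An endofunctor that is the identity on objects, up to equality, and is the identity after a
faithful functor, is the identity. -/
lemma functor_eq_id_of_comp_eq {C D : Type*} [Category* C] [Category* D] (G : C ⥤ D) [G.Faithful]
    {F : C ⥤ C} (hobj : ∀ X, F.obj X = X) (hF : F ⋙ G = G) : F = 𝟭 C := by
  refine CategoryTheory.Functor.ext hobj fun X Y f => G.map_injective ?_
  have := Functor.congr_hom hF f
  simpa [eqToHom_map] using this

lemma entToCov_comp_covToEnt : entToCov.{u} ⋙ covToEnt = 𝟭 _ :=
  functor_eq_id_of_comp_eq PUnifEnt.forget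
    (fun X => PUnifEnt.ext_unif rfl (heq_of_eq (entFilter_covFilter X.isUnif))) rfl

lemma covToEnt_comp_entToCov : covToEnt.{u} ⋙ entToCov = 𝟭 _ :=
  functor_eq_id_of_comp_eq PUnifCov.forget
    (fun X => PUnifCov.ext_unif rfl (heq_of_eq (covFilter_entFilter X.isUnif))) rfl

lemma isUniformCov_entToCov_obj {X : PUnifEnt.{u}} :
    isUniformCov (entToCov.obj X) ↔ isUniformEnt X := by
  refine forall_congr' fun b => ?_
  have h : {a | UnifBelowCov (entToCov.obj X).unif a b} = {a | UnifBelowEnt X.unif a b} :=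
    Set.ext fun _ => X.isUnif.unifBelow_iff.symm
  rw [h]
  rfl

lemma isUniformEnt_covToEnt_obj {X : PUnifCov.{u}} :
    isUniformEnt (covToEnt.obj X) ↔ isUniformCov X := by
  rw [← isUniformCov_entToCov_obj]
  exact iff_of_eq (congrArg isUniformCov (Functor.congr_obj covToEnt_comp_entToCov X))

/-- The restriction of `entToCov` to uniform locales. -/
def uniformEntToCov : UnifEnt.{u} ⥤ UnifCov.{u} :=
  isUniformCov.lift (isUniformEnt.ι ⋙ entToCov) fun X => isUniformCov_entToCov_obj.2 X.property

/-- The restriction of `covToEnt` to uniform locales. -/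
def uniformCovToEnt : UnifCov.{u} ⥤ UnifEnt.{u} :=
  isUniformEnt.lift (isUniformCov.ι ⋙ covToEnt) fun X => isUniformEnt_covToEnt_obj.2 X.property

lemma uniformEntToCov_comp_uniformCovToEnt : uniformEntToCov.{u} ⋙ uniformCovToEnt = 𝟭 _ :=
  functor_eq_id_of_comp_eq (isUniformEnt.ι ⋙ PUnifEnt.forget)
    (fun X => ObjectProperty.FullSubcategory.ext
      (Functor.congr_obj entToCov_comp_covToEnt X.obj)) rfl

lemma uniformCovToEnt_comp_uniformEntToCov : uniformCovToEnt.{u} ⋙ uniformEntToCov = 𝟭 _ :=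
  functor_eq_id_of_comp_eq (isUniformCov.ι ⋙ PUnifCov.forget)
    (fun X => ObjectProperty.FullSubcategory.ext
      (Functor.congr_obj covToEnt_comp_entToCov X.obj)) rfl

/-- Mutually inverse functors form an isomorphism in `Cat`. -/
def catIsoOfFunctors {C D : Type (u + 1)} [Category.{u} C] [Category.{u} D] (F : C ⥤ D)
    (G : D ⥤ C) (hFG : F ⋙ G = 𝟭 C) (hGF : G ⋙ F = 𝟭 D) : Cat.of C ≅ Cat.of D where
  hom := F.toCatHom
  inv := G.toCatHom
  hom_inv_id := Cat.Hom.ext hFG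
  inv_hom_id := Cat.Hom.ext hGF

end Functors

end ULoc

theorem mainTheorem2 :
    ∃ Φ : Cat.of ULoc.PUnifEnt.{u} ≅ Cat.of ULoc.PUnifCov.{u},
      -- the isomorphism commutes with the forgetful functors to overt locales
      Φ.hom.toFunctor ⋙ ULoc.PUnifCov.forget.{u} = ULoc.PUnifEnt.forget.{u} ∧
      Φ.inv.toFunctor ⋙ ULoc.PUnifEnt.forget.{u} = ULoc.PUnifCov.forget.{u} ∧
      -- explicit description of corresponding uniformities on the same overt locale `X`, and
      -- coincidence of their uniformly below relations
      (∀ (X : ULoc.OLoc.{u}) (𝓔 : PFilter (ULoc.ProdOpens (ULoc.Opens X) (ULoc.Opens X)))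
        (h𝓔 : ULoc.IsEntourageUniformity 𝓔) (𝓤 : PFilter (ULoc.CoveringDownset (ULoc.Opens X)))
        (h𝓤 : ULoc.IsCoveringUniformity 𝓤),
        Φ.hom.toFunctor.obj (ULoc.PUnifEnt.mk X 𝓔 h𝓔) = ULoc.PUnifCov.mk X 𝓤 h𝓤 →
          (∀ U, U ∈ 𝓤 ↔ ∃ E ∈ 𝓔, ULoc.hatDownset E ≤ U.1) ∧
          (∀ E, E ∈ 𝓔 ↔ ∃ U ∈ 𝓤, ULoc.IsStrong U.1 ∧ ULoc.barRel U.1 ≤ E) ∧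
          (∀ a b : ULoc.Opens X, ULoc.UnifBelowEnt 𝓔 a b ↔ ULoc.UnifBelowCov 𝓤 a b)) ∧
      -- the isomorphism restricts to one between the categories of uniform locales
      ∃ Ψ : Cat.of ULoc.UnifEnt.{u} ≅ Cat.of ULoc.UnifCov.{u},
        Ψ.hom.toFunctor ⋙ ULoc.isUniformCov.{u}.ι = ULoc.isUniformEnt.{u}.ι ⋙ Φ.hom.toFunctor ∧
        Ψ.inv.toFunctor ⋙ ULoc.isUniformEnt.{u}.ι = ULoc.isUniformCov.{u}.ι ⋙ Φ.inv.toFunctor := by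
  refine ⟨ULoc.catIsoOfFunctors ULoc.entToCov ULoc.covToEnt ULoc.entToCov_comp_covToEnt
    ULoc.covToEnt_comp_entToCov, rfl, rfl, fun X 𝓔 h𝓔 𝓤 h𝓤 h => ?_,
    ULoc.catIsoOfFunctors ULoc.uniformEntToCov ULoc.uniformCovToEnt
      ULoc.uniformEntToCov_comp_uniformCovToEnt ULoc.uniformCovToEnt_comp_uniformEntToCov,
    rfl, rfl⟩
  obtain rfl : h𝓔.covFilter = 𝓤 := eq_of_heq (ULoc.PUnifCov.mk.inj h).2
  exact ⟨fun _ => Iff.rfl, fun _ => h𝓔.mem_iff_exists_barRel_le, fun _ _ => h𝓔.unifBelow_iff⟩
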